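/- For a finite simple graph $X$ with adjacency matrix $A(X)$, let $U_X(t) = \exp(-\mathtt{i}\,t\,A(X))$ for $t \in \mathbb{R}$, and let $\mathbf{e}_v$ denote the standard basis vector of $\mathbb{C}^{V(X)}$ at the vertex $v$. For distinct vertices $a, b$ of $X$ and a real number $\tau \neq 0$, we say that $X$ admits *fractional revival* from $a$ to $b$ at time $\tau$ if there are $\alpha, \beta \in \mathbb{C}$ with $|\alpha|^2 + |\beta|^2 = 1$ and $\beta \neq 0$ such that $$U_X(\tau)\,\mathbf{e}_a = \alpha\,\mathbf{e}_a + \beta\,\mathbf{e}_b ,$$ and that $X$ admits fractional revival if this happens for some distinct vertices $a, b$ and some real $\tau \neq 0$. Let $P_n$ be the unweighted path with vertex set $\{1, \dots, n\}$, where $i$ and $j$ are adjacent if and only if $|i-j| = 1$. **Theorem.** The path $P_n$ admits fractional revival if and only if $n \in \{2, 3, 4\}$. -/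

import Mathlib

open scoped Matrix

noncomputable section

/-- The transition matrix `U(t) = exp(-i t A(X))` of the continuous-time quantum walk on a finite
simple graph `X`, where `A(X)` is the adjacency matrix of `X`. -/
def transitionMatrix {V : Type*} [Fintype V] [DecidableEq V] (X : SimpleGraph V)
    [DecidableRel X.Adj] (t : ℝ) : Matrix V V ℂ :=
  NormedSpace.exp (-(Complex.I * (t : ℂ)) • X.adjMatrix ℂ)

/-- `X` admits fractional revival from `a` to `b` at time `τ`: the vertices are distinct, `τ ≠ 0`
and `U(τ) e_a = α e_a + β e_b` for some complex `α, β` with `|α|² + |β|² = 1` and `β ≠ 0`. -/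
def HasFractionalRevivalAt {V : Type*} [Fintype V] [DecidableEq V] (X : SimpleGraph V)
    [DecidableRel X.Adj] (a b : V) (τ : ℝ) : Prop :=
  a ≠ b ∧ τ ≠ 0 ∧ ∃ α β : ℂ, ‖α‖ ^ 2 + ‖β‖ ^ 2 = 1 ∧ β ≠ 0 ∧
    transitionMatrix X τ *ᵥ Pi.single a 1 = α • Pi.single a 1 + β • Pi.single b 1

/-- `X` admits fractional revival: it does so from some vertex to another one at some time. -/
def AdmitsFractionalRevival {V : Type*} [Fintype V] [DecidableEq V] (X : SimpleGraph V)
    [DecidableRel X.Adj] : Prop :=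
  ∃ (a b : V) (τ : ℝ), HasFractionalRevivalAt X a b τ

end

/-! Put `x = π/(n+1)`. The path has eigenvectors `sin (j k x)` with eigenvalues `2 cos (k x)`. Since
`U(t)` is symmetric, pairing a revival with an eigenvector `v` of eigenvalue `θ` gives `exp(-itθ)
v_a = α v_a + β v_b`. The path is bipartite, so the same condition holds at `-θ` with `β` multiplied
by `(-1)^(a+b)` (`pathGraph_revival_sin_eq`).

If `a + b` is even, `tθ` is a multiple of `π` for `k = 1, 2`, so `cos 2x / cos x` is rational. If `a
+ b` is odd, the normalization of `α, β` makes `a` and `b` mirror images, so `n + 1` is odd;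
comparing phases for `k = 1, 2, 4` makes `(cos 2x - cos 4x) / (cos x + cos 2x)` rational. Either way
`cos x` is a root of a rational quadratic. As it has degree `φ(2(n+1))/2` over `ℚ`, this forces `n +
1 ≤ 6` (`le_six_of_cos_pi_div_quadratic`). The value `6` is excluded by the irrationality of `√3` in
the even case and by parity in the odd case.

For `n = 2, 3, 4`, explicit eigenvectors yield a revival between the end vertices. -/

/-! ### Eigenvectors and the transition matrix -/

open scoped Matrix.Norms.Operator in
theorem Matrix.exp_mulVec_of_mulVec_eq_smul {V : Type*} [Fintype V] [DecidableEq V]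
    {M : Matrix V V ℂ} {v : V → ℂ} {μ : ℂ} (h : M *ᵥ v = μ • v) :
    NormedSpace.exp M *ᵥ v = Complex.exp μ • v := by
  have hpow : ∀ k : ℕ, (M ^ k) *ᵥ v = μ ^ k • v := by
    intro k
    induction k with
    | zero => rw [pow_zero, pow_zero, Matrix.one_mulVec, one_smul]
    | succ k ih =>
      rw [pow_succ, ← Matrix.mulVec_mulVec, h, Matrix.mulVec_smul, ih, smul_smul, pow_succ, mul_comm]
  have h1 := NormedSpace.exp_series_hasSum_exp' (𝕂 := ℂ) M
  let L : Matrix V V ℂ →ₗ[ℂ] (V → ℂ) := (Matrix.mulVecBilin ℂ ℂ).flip v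
  have hL : ∀ N, L N = N *ᵥ v := fun _ => rfl
  have h2 := h1.mapL (LinearMap.toContinuousLinearMap L)
  have h3 := (NormedSpace.exp_series_hasSum_exp' (𝕂 := ℂ) μ).smul_const v
  rw [← Complex.exp_eq_exp_ℂ] at h3
  refine h2.unique ?_
  have h4 : (fun k : ℕ => ((k.factorial : ℂ)⁻¹ • μ ^ k) • v) =
      fun k : ℕ => L ((k.factorial : ℂ)⁻¹ • M ^ k) := by
    funext k
    rw [hL, Matrix.smul_mulVec, hpow, smul_assoc]
  rw [h4] at h3
  exact h3

theorem transitionMatrix_mulVec_of_adjMatrix_mulVec {V : Type*} [Fintype V] [DecidableEq V]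
    (X : SimpleGraph V) [DecidableRel X.Adj] (t : ℝ) {v : V → ℂ} {θ : ℂ}
    (h : X.adjMatrix ℂ *ᵥ v = θ • v) :
    transitionMatrix X t *ᵥ v = Complex.exp (-(Complex.I * t) * θ) • v := by
  refine Matrix.exp_mulVec_of_mulVec_eq_smul ?_
  rw [Matrix.smul_mulVec, h, smul_smul]

theorem transitionMatrix_isSymm {V : Type*} [Fintype V] [DecidableEq V]
    (X : SimpleGraph V) [DecidableRel X.Adj] (t : ℝ) : (transitionMatrix X t).IsSymm :=
  Matrix.IsSymm.exp ((SimpleGraph.isSymm_adjMatrix X).smul _)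

/-- Pairing a fractional revival with an eigenvector of the adjacency matrix. -/
theorem exp_mul_eq_of_adjMatrix_mulVec {V : Type*} [Fintype V] [DecidableEq V]
    {X : SimpleGraph V} [DecidableRel X.Adj] {t : ℝ} {a b : V} {α β : ℂ}
    (hr : transitionMatrix X t *ᵥ Pi.single a 1 = α • Pi.single a 1 + β • Pi.single b 1)
    {v : V → ℂ} {θ : ℂ} (h : X.adjMatrix ℂ *ᵥ v = θ • v) :
    Complex.exp (-(Complex.I * t) * θ) * v a = α * v a + β * v b := by
  have h1 := transitionMatrix_mulVec_of_adjMatrix_mulVec X t h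
  have h2 : v ⬝ᵥ (transitionMatrix X t *ᵥ Pi.single a 1) = (transitionMatrix X t *ᵥ v) a := by
    rw [Matrix.dotProduct_mulVec, ← Matrix.mulVec_transpose, transitionMatrix_isSymm X t]
    simp
  rw [hr, h1] at h2
  simpa [dotProduct_add, dotProduct_smul] using h2.symm

/-! ### Eigenvectors of the path -/

/-- Vertices are numbered from `0` in `Fin n`, hence the shift `i + 1`. The zeros at `0` and `n + 1`
act as ghost neighbours, so the three-term recurrence also covers the two end vertices. -/
theorem pathGraph_adjMatrix_mulVec {n : ℕ} [DecidableRel (SimpleGraph.pathGraph n).Adj]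
    {f : ℕ → ℂ} {θ : ℂ} (h0 : f 0 = 0) (hn : f (n + 1) = 0)
    (hf : ∀ j, f j + f (j + 2) = θ * f (j + 1)) :
    (SimpleGraph.pathGraph n).adjMatrix ℂ *ᵥ (fun i => f (i + 1)) = θ • fun i : Fin n => f (i + 1) := by
  ext i
  have hi := i.2
  have key : ∀ j : Fin n, (SimpleGraph.pathGraph n).adjMatrix ℂ i j * f (j + 1) =
      (if (j : ℕ) = i + 1 then f (j + 1) else 0) + (if (j : ℕ) + 1 = i then f (j + 1) else 0) := by
    intro j
    rw [SimpleGraph.adjMatrix_apply]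
    simp only [SimpleGraph.pathGraph_adj]
    split_ifs <;> first | omega | simp
  simp only [Matrix.mulVec, dotProduct, key, Finset.sum_add_distrib, Pi.smul_apply, smul_eq_mul]
  rw [Fin.sum_univ_eq_sum_range (fun j => if j = (i : ℕ) + 1 then f (j + 1) else 0) n,
    Fin.sum_univ_eq_sum_range (fun j => if j + 1 = (i : ℕ) then f (j + 1) else 0) n,
    Finset.sum_ite_eq', ← hf, add_comm]
  congr 1
  · rcases Nat.eq_zero_or_pos (i : ℕ) with hz | hz
    · rw [hz, h0]
      exact Finset.sum_eq_zero fun j _ => by simp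
    · rw [Finset.sum_eq_single ((i : ℕ) - 1)]
      · simp [Nat.sub_add_cancel hz]
      · intro j _ hj
        rw [if_neg (by omega)]
      · intro hj
        exact absurd (Finset.mem_range.2 (by omega)) hj
  · split_ifs with hlt
    · rfl
    · rw [Finset.mem_range] at hlt
      rw [← hn]
      congr 1
      omega

theorem pathGraph_adjMatrix_mulVec_sin {n : ℕ} [DecidableRel (SimpleGraph.pathGraph n).Adj]
    {y : ℝ} (hy : Real.sin ((n + 1 : ℕ) * y) = 0) :
    (SimpleGraph.pathGraph n).adjMatrix ℂ *ᵥ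
        (fun i => ((Real.sin ((i + 1 : ℕ) * y) : ℝ) : ℂ)) =
      ((2 * Real.cos y : ℝ) : ℂ) • fun i : Fin n => ((Real.sin ((i + 1 : ℕ) * y) : ℝ) : ℂ) := by
  refine pathGraph_adjMatrix_mulVec (f := fun j => ((Real.sin ((j : ℕ) * y) : ℝ) : ℂ))
    (by simp) (by rw [hy]; simp) fun j => ?_
  rw [← Complex.ofReal_add, ← Complex.ofReal_mul]
  congr 1
  have e1 : ((j : ℕ) : ℝ) * y = (j + 1 : ℕ) * y - y := by push_cast; ring
  have e2 : ((j + 2 : ℕ) : ℝ) * y = (j + 1 : ℕ) * y + y := by push_cast; ring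
  rw [e1, e2, Real.sin_sub, Real.sin_add]
  ring

/-! ### The degree of `cos (π / m)` over `ℚ` -/

theorem Nat.coprime_of_odd_of_intCast_comb_eq_eight {N x : ℕ} (hx : Odd x) {i j : ℤ}
    (h : i * N + j * x = 8) : N.Coprime x := by
  have h8 : N.gcd x ∣ 2 ^ 3 := by
    have h1 : ((N.gcd x : ℕ) : ℤ) ∣ i * N + j * x :=
      dvd_add (Dvd.dvd.mul_left (Int.natCast_dvd_natCast.2 (Nat.gcd_dvd_left N x)) i)
        (Dvd.dvd.mul_left (Int.natCast_dvd_natCast.2 (Nat.gcd_dvd_right N x)) j)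
    rw [h] at h1
    exact_mod_cast h1
  have h2 : (N.gcd x).Coprime 2 :=
    Nat.Coprime.coprime_dvd_left (Nat.gcd_dvd_right N x) (Nat.coprime_two_right.2 hx)
  exact Nat.Coprime.eq_one_of_dvd (h2.pow_right 3) h8

/-- Five units modulo `2m` are exhibited: `1`, `2m - 1`, `m ± d` with `d` chosen to make them odd,
and an odd `t` close to `m / 2`. Coprimality comes from integer combinations equal to `8`. -/
theorem four_lt_totient_two_mul {m : ℕ} (hm : 7 ≤ m) : 4 < Nat.totient (2 * m) := by
  have key : ∀ s : Finset ℕ, (∀ x ∈ s, x < 2 * m ∧ (2 * m).Coprime x) →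
      s.card ≤ Nat.totient (2 * m) := fun s hs =>
    Finset.card_le_card fun x hx => Finset.mem_filter.2 ⟨Finset.mem_range.2 (hs x hx).1, (hs x hx).2⟩
  have cop : ∀ x : ℕ, ∀ i j : ℤ, x % 2 = 1 → i * (2 * m) + j * x = 8 → (2 * m).Coprime x :=
    fun x i j hx h => Nat.coprime_of_odd_of_intCast_comb_eq_eight (Nat.odd_iff.2 hx)
      (i := i) (j := j) (by push_cast; exact h)
  have fin : ∀ d t : ℕ, 1 < t → t < m - d → 0 < d → (2 * m).Coprime (m - d) →
      (2 * m).Coprime (m + d) → (2 * m).Coprime t → d < m - 1 → 4 < Nat.totient (2 * m) := by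
    intro d t h1 h2 h3 h4 h5 h6 h7
    have hc : ({1, t, m - d, m + d, 2 * m - 1} : Finset ℕ).card = 5 := by
      rw [Finset.card_insert_of_notMem, Finset.card_insert_of_notMem,
        Finset.card_insert_of_notMem, Finset.card_pair] <;>
      (try simp only [Finset.mem_insert, Finset.mem_singleton]) <;> omega
    have hk := key {1, t, m - d, m + d, 2 * m - 1} (by
      simp only [Finset.mem_insert, Finset.mem_singleton]
      rintro x (rfl | rfl | rfl | rfl | rfl)
      · exact ⟨by omega, Nat.coprime_one_right _⟩
      · exact ⟨by omega, h6⟩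
      · exact ⟨by omega, h4⟩
      · exact ⟨by omega, h5⟩
      · exact ⟨by omega, cop _ 8 (-8) (by omega) (by omega)⟩)
    omega
  have h4 : m % 4 < 4 := Nat.mod_lt _ (by norm_num)
  have hdiv := Nat.div_add_mod m 4
  interval_cases hr : m % 4
  · exact fin 1 (2 * (m / 4) + 1) (by omega) (by omega) (by omega)
      (cop _ 4 (-8) (by omega) (by omega)) (cop _ (-4) 8 (by omega) (by omega))
      (cop _ (-2) 8 (by omega) (by omega)) (by omega)
  · exact fin 2 (2 * (m / 4) + 1) (by omega) (by omega) (by omega)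
      (cop _ 2 (-4) (by omega) (by omega)) (cop _ (-2) 4 (by omega) (by omega))
      (cop _ (-4) 16 (by omega) (by omega)) (by omega)
  · exact fin 1 (2 * (m / 4) + 3) (by omega) (by omega) (by omega)
      (cop _ 4 (-8) (by omega) (by omega)) (cop _ (-4) 8 (by omega) (by omega))
      (cop _ (-1) 4 (by omega) (by omega)) (by omega)
  · exact fin 2 (2 * (m / 4) + 1) (by omega) (by omega) (by omega)
      (cop _ 2 (-4) (by omega) (by omega)) (cop _ (-2) 4 (by omega) (by omega))
      (cop _ 4 (-16) (by omega) (by omega)) (by omega)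

theorem le_six_of_cos_pi_div_quadratic {m : ℕ} {u v w : ℚ} (hu : u ≠ 0)
    (h : (u : ℝ) * Real.cos (Real.pi / m) ^ 2 + v * Real.cos (Real.pi / m) + w = 0) : m ≤ 6 := by
  by_contra! hm7
  have h4 := four_lt_totient_two_mul hm7
  set ζ : ℂ := Complex.exp (2 * Real.pi * Complex.I / (2 * m : ℕ)) with hζ
  have hprim : IsPrimitiveRoot ζ (2 * m) := Complex.isPrimitiveRoot_exp _ (by omega)
  have hζ0 : ζ ≠ 0 := Complex.exp_ne_zero _
  have hcos : (2 : ℂ) * (Real.cos (Real.pi / m) : ℝ) = ζ + ζ⁻¹ := by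
    have e : (2 * Real.pi * Complex.I / (2 * m : ℕ) : ℂ) = (Real.pi / m : ℝ) * Complex.I := by
      push_cast
      field_simp
    rw [hζ, e, ← Complex.exp_neg, Complex.ofReal_cos, Complex.two_cos, neg_mul]
  -- Substitute `2 cos (π / m) = ζ + ζ⁻¹` into the quadratic and multiply by `4 ζ ^ 2`.
  let p : Polynomial ℚ := Polynomial.C u * Polynomial.X ^ 4 +
    (Polynomial.C (2 * v) * Polynomial.X ^ 3 + Polynomial.C (2 * u + 4 * w) * Polynomial.X ^ 2 +
      Polynomial.C (2 * v) * Polynomial.X + Polynomial.C u)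
  have hp : p.natDegree = 4 := by
    simp only [p]
    compute_degree!
  have hp0 : p ≠ 0 := by
    intro h0
    rw [h0] at hp
    simp at hp
  have hroot : Polynomial.aeval ζ p = 0 := by
    have h' : (u : ℂ) * (Real.cos (Real.pi / m) : ℝ) ^ 2 + v * (Real.cos (Real.pi / m) : ℝ) + w = 0 := by
      exact_mod_cast h
    have hinv : ζ * ζ⁻¹ = 1 := mul_inv_cancel₀ hζ0
    have hc : ζ ^ 2 + 1 = ζ * (2 * (Real.cos (Real.pi / m) : ℝ)) := by
      rw [hcos]; linear_combination -hinv
    simp only [p, map_add, map_mul, map_pow, Polynomial.aeval_C, Polynomial.aeval_X,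
      eq_ratCast, Rat.cast_ofNat]
    linear_combination 4 * ζ ^ 2 * h' + (u * (ζ ^ 2 + 1 + ζ * (2 * (Real.cos (Real.pi / m) : ℝ))) + 2 * v * ζ) * hc
  have hdeg := Polynomial.natDegree_le_natDegree (minpoly.degree_le_of_ne_zero ℚ ζ hp0 hroot)
  rw [← Polynomial.cyclotomic_eq_minpoly_rat hprim (by omega), Polynomial.natDegree_cyclotomic,
    hp] at hdeg
  omega

/-! ### Conditions imposed by a revival on a path -/

theorem Real.sin_natCast_mul_pi_div_eq_zero_iff {m j : ℕ} (hm : 0 < m) :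
    Real.sin (j * (Real.pi / m)) = 0 ↔ m ∣ j := by
  have hm' : (m : ℝ) ≠ 0 := by positivity
  rw [Real.sin_eq_zero_iff]
  constructor
  · rintro ⟨k, hk⟩
    have h1 : (k : ℝ) * m = j := by
      have := Real.pi_ne_zero
      field_simp at hk
      linarith
    have h2 : k * m = (j : ℤ) := by exact_mod_cast h1
    exact Int.natCast_dvd_natCast.1 ⟨k, by rw [← h2, mul_comm]⟩
  · rintro ⟨k, rfl⟩
    refine ⟨k, ?_⟩
    push_cast
    field_simp

/-- The conditions that a fractional revival imposes at an eigenvalue `2 cos y` and its negative. -/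
theorem pathGraph_revival_sin_eq {n : ℕ} [DecidableRel (SimpleGraph.pathGraph n).Adj]
    {t : ℝ} {a b : Fin n} {α β : ℂ}
    (hr : transitionMatrix (SimpleGraph.pathGraph n) t *ᵥ Pi.single a 1 =
      α • Pi.single a 1 + β • Pi.single b 1)
    {y : ℝ} (hy : Real.sin ((n + 1 : ℕ) * y) = 0) :
    Complex.exp (-((t * (2 * Real.cos y) : ℝ) * Complex.I)) * Real.sin ((a + 1 : ℕ) * y) =
      α * Real.sin ((a + 1 : ℕ) * y) + β * Real.sin ((b + 1 : ℕ) * y) ∧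
    Complex.exp ((t * (2 * Real.cos y) : ℝ) * Complex.I) * Real.sin ((a + 1 : ℕ) * y) =
      α * Real.sin ((a + 1 : ℕ) * y) + (-1) ^ (a + b : ℕ) * β * Real.sin ((b + 1 : ℕ) * y) := by
  have h1 := exp_mul_eq_of_adjMatrix_mulVec hr (pathGraph_adjMatrix_mulVec_sin hy)
  have hshift : ∀ j : ℕ, Real.sin (j * (y + Real.pi)) = (-1) ^ j * Real.sin (j * y) := fun j => by
    rw [mul_add, Real.sin_add_nat_mul_pi]
  -- Replacing `y` by `y + π` negates the eigenvalue and alternates the signs of the eigenvector.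
  have h2 := exp_mul_eq_of_adjMatrix_mulVec hr
    (pathGraph_adjMatrix_mulVec_sin (y := y + Real.pi) (by rw [hshift, hy, mul_zero]))
  simp only [hshift, Real.cos_add_pi] at h2
  have e1 : -((t * (2 * Real.cos y) : ℝ) * Complex.I) =
      -(Complex.I * t) * (2 * Real.cos y : ℝ) := by push_cast; ring
  have e2 : ((t * (2 * Real.cos y) : ℝ) * Complex.I) =
      -(Complex.I * t) * (2 * -Real.cos y : ℝ) := by push_cast; ring
  refine ⟨by rw [e1]; exact h1, ?_⟩
  rw [e2]
  push_cast at h2 ⊢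
  have ha : ((-1 : ℂ) ^ (a : ℕ)) * (-1) ^ (a : ℕ) = 1 := by rw [← mul_pow]; simp
  simp only [pow_succ, pow_add] at h2 ⊢
  linear_combination (-(-1 : ℂ) ^ (a : ℕ)) * h2 + (Complex.exp (-(Complex.I * t) * (2 * -Complex.cos y)) * Complex.sin ((a + 1) * y) - α * Complex.sin ((a + 1) * y)) * (-ha)

theorem Real.sin_natCast_mul_natCast_mul_pi_div (m k j : ℕ) :
    Real.sin (j * (k * (Real.pi / m))) = Real.sin ((k * j : ℕ) * (Real.pi / m)) := by
  congr 1; push_cast; ring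

theorem Real.sin_natCast_mul_natCast_mul_pi_div_self {m : ℕ} (hm : 0 < m) (k : ℕ) :
    Real.sin (m * (k * (Real.pi / m))) = 0 := by
  rw [Real.sin_natCast_mul_natCast_mul_pi_div, Real.sin_natCast_mul_pi_div_eq_zero_iff hm]
  exact dvd_mul_left _ _

/-- The eigenvector with `k = 2` vanishes only at the middle vertex. If `a` were the middle, the
pairing would make it vanish at `b` too, forcing `b = a`. -/
theorem ne_half_of_pathGraph_revival {n : ℕ} [DecidableRel (SimpleGraph.pathGraph n).Adj]
    {t : ℝ} {a b : Fin n} {α β : ℂ} (hab : a ≠ b) (hβ : β ≠ 0)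
    (hr : transitionMatrix (SimpleGraph.pathGraph n) t *ᵥ Pi.single a 1 =
      α • Pi.single a 1 + β • Pi.single b 1) : 2 * (a + 1 : ℕ) ≠ n + 1 := by
  intro h
  have h1 := (pathGraph_revival_sin_eq hr (y := (2 : ℕ) * (Real.pi / (n + 1 : ℕ)))
    (Real.sin_natCast_mul_natCast_mul_pi_div_self n.succ_pos 2)).1
  have h0 : Real.sin ((2 * (a + 1) : ℕ) * (Real.pi / (n + 1 : ℕ))) = 0 :=
    (Real.sin_natCast_mul_pi_div_eq_zero_iff n.succ_pos).2 (by rw [h])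
  rw [Real.sin_natCast_mul_natCast_mul_pi_div, Real.sin_natCast_mul_natCast_mul_pi_div, h0] at h1
  have h2 : Real.sin ((2 * (b + 1) : ℕ) * (Real.pi / (n + 1 : ℕ))) = 0 := by
    rw [Complex.ofReal_zero, mul_zero, mul_zero, zero_add] at h1
    exact Complex.ofReal_eq_zero.1 ((mul_eq_zero.1 h1.symm).resolve_left hβ)
  rw [Real.sin_natCast_mul_pi_div_eq_zero_iff n.succ_pos] at h2
  obtain ⟨c, hc⟩ := h2
  have hb := b.2
  have hc1 : c = 1 := by
    have : c < 2 := by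
      by_contra! hc2
      nlinarith
    have : c ≠ 0 := by
      rintro rfl
      omega
    omega
  subst hc1
  exact hab (Fin.ext (by omega))

/-! ### Rational relations between eigenvalues -/

theorem Real.cos_pi_div_pos {m : ℕ} (hm : 2 < m) : 0 < Real.cos (Real.pi / m) := by
  have h3 : (2 : ℝ) < m := by exact_mod_cast hm
  refine Real.cos_pos_of_mem_Ioo ⟨?_, ?_⟩
  · have : 0 < Real.pi / m := by positivity
    linarith [Real.pi_pos]
  · exact div_lt_div_of_pos_left Real.pi_pos (by norm_num) h3

theorem Real.half_lt_cos_pi_div {m : ℕ} (hm : 3 < m) : 1 / 2 < Real.cos (Real.pi / m) := by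
  have h3 : (3 : ℝ) < m := by exact_mod_cast hm
  rw [← Real.cos_pi_div_three]
  exact Real.cos_lt_cos_of_nonneg_of_le_pi (by positivity) (by linarith [Real.pi_pos])
    (div_lt_div_of_pos_left Real.pi_pos (by norm_num) h3)

theorem le_five_of_cos_two_pi_div_proportional {m : ℕ} (hm : 2 < m) {p q : ℤ} (hp : p ≠ 0)
    (h : Real.cos (2 * (Real.pi / m)) * p = q * Real.cos (Real.pi / m)) : m ≤ 5 := by
  rw [Real.cos_two_mul] at h
  have h6 : m ≤ 6 := le_six_of_cos_pi_div_quadratic (u := 2 * p) (v := -q) (w := -p)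
    (by exact_mod_cast mul_ne_zero two_ne_zero hp) (by push_cast; linarith)
  rcases h6.lt_or_eq with h6 | rfl
  · omega
  -- `cos (π / 6) = √3 / 2` does have degree two, so `m = 6` needs its own argument.
  exfalso
  have e : Real.cos (Real.pi / (6 : ℕ)) = Real.sqrt 3 / 2 := by
    rw [← Real.cos_pi_div_six]; norm_num
  rw [e, div_pow, Real.sq_sqrt (by norm_num)] at h
  have hpq : (p : ℝ) = q * Real.sqrt 3 := by linarith
  have hq : (q : ℝ) ≠ 0 := by
    intro hq
    rw [hq, zero_mul] at hpq
    exact hp (by exact_mod_cast hpq)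
  have irr : Irrational (Real.sqrt 3) := by
    have := Nat.Prime.irrational_sqrt (p := 3) (by norm_num)
    exact_mod_cast this
  refine irr ⟨p / q, ?_⟩
  push_cast
  rw [hpq]
  field_simp

theorem le_six_of_cos_pi_div_commensurable {m : ℕ} (hm : 3 < m) {t : ℝ} (ht : t ≠ 0) {p q : ℤ}
    (hp : (p : ℝ) = t * (Real.cos (Real.pi / m) + Real.cos (2 * (Real.pi / m))))
    (hq : (q : ℝ) = t * (Real.cos (2 * (Real.pi / m)) - Real.cos (4 * (Real.pi / m)))) :
    m ≤ 6 := by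
  have hc := Real.half_lt_cos_pi_div hm
  have e4 : 4 * (Real.pi / m) = 2 * (2 * (Real.pi / m)) := by ring
  rw [e4, Real.cos_two_mul (2 * _), Real.cos_two_mul] at hq
  rw [Real.cos_two_mul] at hp
  set c := Real.cos (Real.pi / m)
  have hp0 : (p : ℝ) ≠ 0 := by
    rw [hp]
    have : c + (2 * c ^ 2 - 1) = (2 * c - 1) * (c + 1) := by ring
    rw [this]
    exact mul_ne_zero ht (mul_ne_zero (by linarith) (by linarith))
  have hpz : p ≠ 0 := by exact_mod_cast hp0
  -- With `c = cos (π / m)`, both sums share the factor `(2c - 1)(c + 1)`, and the quotient `q / p`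
  -- is `2(1 - c)(2c + 1)`.
  refine le_six_of_cos_pi_div_quadratic (u := -4 * p) (v := 2 * p) (w := 2 * p - q)
    (mul_ne_zero (by norm_num) (by exact_mod_cast hpz)) ?_
  push_cast
  rw [hp, hq]
  ring

/-! ### The bound `n ≤ 4`, by the parity of `a + b` -/

theorem sin_eq_zero_of_pathGraph_revival_of_even {n : ℕ}
    [DecidableRel (SimpleGraph.pathGraph n).Adj] {t : ℝ} {a b : Fin n} {α β : ℂ}
    (hr : transitionMatrix (SimpleGraph.pathGraph n) t *ᵥ Pi.single a 1 =
      α • Pi.single a 1 + β • Pi.single b 1) (hpar : Even (a + b : ℕ))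
    {y : ℝ} (hy : Real.sin ((n + 1 : ℕ) * y) = 0) (ha : Real.sin ((a + 1 : ℕ) * y) ≠ 0) :
    Real.sin (t * (2 * Real.cos y)) = 0 := by
  obtain ⟨h1, h2⟩ := pathGraph_revival_sin_eq hr hy
  rw [hpar.neg_one_pow, one_mul, ← h1] at h2
  have h3 := mul_right_cancel₀ (Complex.ofReal_ne_zero.2 ha) h2
  have h4 := Complex.two_sin (t * (2 * Real.cos y) : ℝ)
  rw [h3, neg_mul, sub_self, zero_mul, ← Complex.ofReal_sin] at h4
  exact Complex.ofReal_eq_zero.1 ((mul_eq_zero.1 h4).resolve_left two_ne_zero)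

theorem pathGraph_revival_of_odd {n : ℕ} [DecidableRel (SimpleGraph.pathGraph n).Adj]
    {t : ℝ} {a b : Fin n} {α β : ℂ}
    (hr : transitionMatrix (SimpleGraph.pathGraph n) t *ᵥ Pi.single a 1 =
      α • Pi.single a 1 + β • Pi.single b 1) (hpar : Odd (a + b : ℕ))
    {y : ℝ} (hy : Real.sin ((n + 1 : ℕ) * y) = 0) (ha : Real.sin ((a + 1 : ℕ) * y) ≠ 0) :
    (Real.cos (t * (2 * Real.cos y)) : ℂ) = α ∧
      -(Real.sin (t * (2 * Real.cos y)) * Real.sin ((a + 1 : ℕ) * y) : ℝ) * Complex.I =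
        β * Real.sin ((b + 1 : ℕ) * y) := by
  obtain ⟨h1, h2⟩ := pathGraph_revival_sin_eq hr hy
  rw [hpar.neg_one_pow] at h2
  rw [← neg_mul, Complex.exp_mul_I, Complex.cos_neg, Complex.sin_neg, ← Complex.ofReal_cos,
    ← Complex.ofReal_sin] at h1
  rw [Complex.exp_mul_I, ← Complex.ofReal_cos, ← Complex.ofReal_sin] at h2
  constructor
  · refine mul_right_cancel₀ (Complex.ofReal_ne_zero.2 ha) ?_
    linear_combination (h1 + h2) / 2
  · rw [Complex.ofReal_mul]
    linear_combination (h1 - h2) / 2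

theorem pathGraph_revival_sin_ne_zero {n : ℕ} [DecidableRel (SimpleGraph.pathGraph n).Adj]
    {t : ℝ} {a b : Fin n} {α β : ℂ} (hab : a ≠ b) (hβ : β ≠ 0)
    (hr : transitionMatrix (SimpleGraph.pathGraph n) t *ᵥ Pi.single a 1 =
      α • Pi.single a 1 + β • Pi.single b 1) :
    Real.sin ((a + 1 : ℕ) * ((2 : ℕ) * (Real.pi / (n + 1 : ℕ)))) ≠ 0 := by
  rw [Real.sin_natCast_mul_natCast_mul_pi_div, Ne,
    Real.sin_natCast_mul_pi_div_eq_zero_iff n.succ_pos]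
  rintro ⟨c, hc⟩
  have ha := a.2
  have h1 := ne_half_of_pathGraph_revival hab hβ hr
  have : c < 2 := by
    by_contra! hc2
    nlinarith
  interval_cases c <;> omega

theorem Real.sin_natCast_mul_pi_div_pos {m j : ℕ} (hj : 0 < j) (hjm : j < m) :
    0 < Real.sin (j * (Real.pi / m)) := by
  have hm : (0 : ℝ) < m := by exact_mod_cast hj.trans hjm
  refine Real.sin_pos_of_pos_of_lt_pi (by positivity) ?_
  rw [← mul_div_assoc, div_lt_iff₀ hm, mul_comm]
  exact mul_lt_mul_of_pos_left (by exact_mod_cast hjm) Real.pi_pos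

theorem le_four_of_pathGraph_revival_of_even {n : ℕ}
    [DecidableRel (SimpleGraph.pathGraph n).Adj] {t : ℝ} (ht : t ≠ 0) {a b : Fin n} {α β : ℂ}
    (hab : a ≠ b) (hβ : β ≠ 0)
    (hr : transitionMatrix (SimpleGraph.pathGraph n) t *ᵥ Pi.single a 1 =
      α • Pi.single a 1 + β • Pi.single b 1) (hpar : Even (a + b : ℕ)) : n ≤ 4 := by
  have h2n : 2 < n + 1 := by
    have := a.2
    have := b.2
    have := fun h => hab (Fin.ext h)
    omega
  have h1 := sin_eq_zero_of_pathGraph_revival_of_even hr hpar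
    (by simpa using Real.sin_natCast_mul_natCast_mul_pi_div_self n.succ_pos 1)
    (Real.sin_natCast_mul_pi_div_pos (j := a + 1) (m := n + 1) (by omega) (by omega)).ne'
  have h2 := sin_eq_zero_of_pathGraph_revival_of_even hr hpar
    (Real.sin_natCast_mul_natCast_mul_pi_div_self n.succ_pos 2)
    (pathGraph_revival_sin_ne_zero hab hβ hr)
  obtain ⟨p, hp⟩ := Real.sin_eq_zero_iff.1 h1
  obtain ⟨q, hq⟩ := Real.sin_eq_zero_iff.1 h2
  have hc := Real.cos_pi_div_pos h2n
  have hp0 : p ≠ 0 := by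
    rintro rfl
    rw [Int.cast_zero, zero_mul] at hp
    exact mul_ne_zero ht (mul_ne_zero two_ne_zero hc.ne') hp.symm
  have := le_five_of_cos_two_pi_div_proportional h2n (q := q) hp0 (by
    rw [Nat.cast_two] at hq
    have hpi := Real.pi_ne_zero
    refine mul_right_cancel₀ (mul_ne_zero (mul_ne_zero ht hpi) two_ne_zero) ?_
    linear_combination (2 * t * Real.cos (2 * (Real.pi / (n + 1 : ℕ)))) * hp -
      (2 * t * Real.cos (Real.pi / (n + 1 : ℕ))) * hq)
  omega

/-- For `k = 1` the phase gives `α = cos θ`, so normalization gives `|β| = |sin θ|`. The positive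
eigenvector then has equal entries at `a` and `b`, which for `a ≠ b` means mirror images. -/
theorem add_add_two_eq_of_pathGraph_revival_of_odd {n : ℕ}
    [DecidableRel (SimpleGraph.pathGraph n).Adj] {t : ℝ} {a b : Fin n} {α β : ℂ}
    (hab : a ≠ b) (hαβ : ‖α‖ ^ 2 + ‖β‖ ^ 2 = 1) (hβ : β ≠ 0)
    (hr : transitionMatrix (SimpleGraph.pathGraph n) t *ᵥ Pi.single a 1 =
      α • Pi.single a 1 + β • Pi.single b 1) (hpar : Odd (a + b : ℕ)) :
    (a + 1) + (b + 1) = n + 1 := by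
  have hsa := Real.sin_natCast_mul_pi_div_pos (j := a + 1) (m := n + 1) (by omega) (by omega)
  have hsb := Real.sin_natCast_mul_pi_div_pos (j := b + 1) (m := n + 1) (by omega) (by omega)
  obtain ⟨h1, h2⟩ := pathGraph_revival_of_odd hr hpar
    (by simpa using Real.sin_natCast_mul_natCast_mul_pi_div_self n.succ_pos 1) hsa.ne'
  set x := Real.pi / (n + 1 : ℕ) with hx
  set θ := t * (2 * Real.cos x)
  have h3 : ‖α‖ ^ 2 = Real.cos θ ^ 2 := by
    rw [← h1, Complex.norm_real, Real.norm_eq_abs, sq_abs]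
  have h4 : Real.sin θ ^ 2 * Real.sin ((a + 1 : ℕ) * x) ^ 2 =
      ‖β‖ ^ 2 * Real.sin ((b + 1 : ℕ) * x) ^ 2 := by
    have := congrArg (fun z : ℂ => ‖z‖ ^ 2) h2
    simpa [mul_pow, -Complex.ofReal_mul, -Complex.ofReal_sin, Complex.norm_real,
      -Nat.cast_add] using this
  have h5 : ‖β‖ ^ 2 = Real.sin θ ^ 2 := by
    linarith [Real.sin_sq_add_cos_sq θ]
  have hβ2 : ‖β‖ ^ 2 ≠ 0 := pow_ne_zero _ (norm_ne_zero_iff.2 hβ)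
  rw [← h5] at h4
  have h6 : Real.sin ((a + 1 : ℕ) * x) = Real.sin ((b + 1 : ℕ) * x) :=
    (pow_left_inj₀ hsa.le hsb.le two_ne_zero).1 (mul_left_cancel₀ hβ2 h4)
  have ha := a.2
  have hb := b.2
  have hx0 : x ≠ 0 := by positivity
  have hpi : Real.pi = (n + 1 : ℕ) * x := by
    rw [hx]; field_simp
  obtain ⟨k, hk | hk⟩ := Real.sin_eq_sin_iff.1 h6
  · rw [hpi] at hk
    have hk1 : ((b + 1 : ℕ) : ℝ) = 2 * k * (n + 1 : ℕ) + (a + 1 : ℕ) :=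
      mul_right_cancel₀ hx0 (by linear_combination hk)
    have hk2 : ((b + 1 : ℕ) : ℤ) = 2 * k * (n + 1 : ℕ) + (a + 1 : ℕ) := by exact_mod_cast hk1
    have hk3 : k < 1 := by
      by_contra! hk
      push_cast at hk2
      nlinarith
    have hk4 : -1 < k := by
      by_contra! hk
      push_cast at hk2
      nlinarith
    have hk5 : k = 0 := by omega
    subst hk5
    exact absurd (Fin.ext (by omega)) hab
  · rw [hpi] at hk
    have hk1 : ((b + 1 : ℕ) : ℝ) = (2 * k + 1) * (n + 1 : ℕ) - (a + 1 : ℕ) :=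
      mul_right_cancel₀ hx0 (by linear_combination hk)
    have hk2 : ((b + 1 : ℕ) : ℤ) = (2 * k + 1) * (n + 1 : ℕ) - (a + 1 : ℕ) := by
      exact_mod_cast hk1
    have hk3 : k < 1 := by
      by_contra! hk
      push_cast at hk2
      nlinarith
    have hk4 : -1 < k := by
      by_contra! hk
      push_cast at hk2
      nlinarith
    have hk5 : k = 0 := by omega
    subst hk5
    omega

/-- The phases of a fractional revival at the eigenvalue `2 cos (k π / (n + 1))`, `k` even. -/
theorem pathGraph_revival_of_odd_of_even_mul {n : ℕ}
    [DecidableRel (SimpleGraph.pathGraph n).Adj] {t : ℝ} {a b : Fin n} {α β : ℂ}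
    (hr : transitionMatrix (SimpleGraph.pathGraph n) t *ᵥ Pi.single a 1 =
      α • Pi.single a 1 + β • Pi.single b 1) (hpar : Odd (a + b : ℕ))
    (hsum : (a + 1 : ℕ) + (b + 1 : ℕ) = n + 1) {k : ℕ} (hk : Even k)
    (hs : Real.sin ((a + 1 : ℕ) * (k * (Real.pi / (n + 1 : ℕ)))) ≠ 0) :
    (Real.cos (t * (2 * Real.cos (k * (Real.pi / (n + 1 : ℕ))))) : ℂ) = α ∧
      Real.sin (t * (2 * Real.cos (k * (Real.pi / (n + 1 : ℕ))))) * Complex.I = β := by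
  obtain ⟨h1, h2⟩ := pathGraph_revival_of_odd hr hpar
    (Real.sin_natCast_mul_natCast_mul_pi_div_self n.succ_pos k) hs
  refine ⟨h1, ?_⟩
  -- For even `k` the eigenvector is antisymmetric under the reflection exchanging `a` and `b`.
  have h3 : Real.sin ((b + 1 : ℕ) * (k * (Real.pi / (n + 1 : ℕ)))) =
      -Real.sin ((a + 1 : ℕ) * (k * (Real.pi / (n + 1 : ℕ)))) := by
    obtain ⟨r, rfl⟩ := hk
    have e : ((b + 1 : ℕ) : ℝ) = (n + 1 : ℕ) - (a + 1 : ℕ) := by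
      have := congrArg (Nat.cast (R := ℝ)) hsum; push_cast at this ⊢; linarith
    have e2 : ((b + 1 : ℕ) : ℝ) * ((r + r : ℕ) * (Real.pi / (n + 1 : ℕ))) =
        -((a + 1 : ℕ) * ((r + r : ℕ) * (Real.pi / (n + 1 : ℕ)))) + r * (2 * Real.pi) := by
      rw [e]
      push_cast
      field_simp
      ring
    rw [e2, Real.sin_add_nat_mul_two_pi, Real.sin_neg]
  rw [h3, Complex.ofReal_neg] at h2
  refine mul_right_cancel₀ (Complex.ofReal_ne_zero.2 hs) ?_
  rw [Complex.ofReal_mul] at h2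
  linear_combination -h2

theorem Real.exists_int_of_cos_eq_of_sin_eq {x y : ℝ} (hc : Real.cos x = Real.cos y)
    (hs : Real.sin x = Real.sin y) : ∃ k : ℤ, (k : ℝ) * (2 * Real.pi) = x - y := by
  rw [← Real.cos_eq_one_iff, Real.cos_sub, hc, hs]
  nlinarith [Real.sin_sq_add_cos_sq y]

theorem le_four_of_pathGraph_revival_of_odd {n : ℕ}
    [DecidableRel (SimpleGraph.pathGraph n).Adj] {t : ℝ} (ht : t ≠ 0) {a b : Fin n} {α β : ℂ}
    (hab : a ≠ b) (hαβ : ‖α‖ ^ 2 + ‖β‖ ^ 2 = 1) (hβ : β ≠ 0)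
    (hr : transitionMatrix (SimpleGraph.pathGraph n) t *ᵥ Pi.single a 1 =
      α • Pi.single a 1 + β • Pi.single b 1) (hpar : Odd (a + b : ℕ)) : n ≤ 4 := by
  have hsum := add_add_two_eq_of_pathGraph_revival_of_odd hab hαβ hβ hr hpar
  have hnpar : (n + 1) % 2 = 1 := by
    have := Nat.odd_iff.1 hpar
    omega
  by_contra! hn
  have hsa := Real.sin_natCast_mul_pi_div_pos (j := a + 1) (m := n + 1) (by omega) (by omega)
  obtain ⟨hc1, hs1⟩ := pathGraph_revival_of_odd hr hpar
    (by simpa using Real.sin_natCast_mul_natCast_mul_pi_div_self n.succ_pos 1) hsa.ne'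
  obtain ⟨hc2, hs2⟩ := pathGraph_revival_of_odd_of_even_mul hr hpar hsum (k := 2) (by decide)
    (pathGraph_revival_sin_ne_zero hab hβ hr)
  obtain ⟨hc4, hs4⟩ := pathGraph_revival_of_odd_of_even_mul hr hpar hsum (k := 4) (by decide) (by
    rw [Real.sin_natCast_mul_natCast_mul_pi_div, Ne,
      Real.sin_natCast_mul_pi_div_eq_zero_iff n.succ_pos]
    intro hdvd
    have hcop : (n + 1).Coprime (2 ^ 2) :=
      (Nat.coprime_two_right.2 (Nat.odd_iff.2 hnpar)).pow_right 2
    have := Nat.le_of_dvd (by omega) (hcop.dvd_of_dvd_mul_left hdvd)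
    omega)
  have e : ((b + 1 : ℕ) : ℝ) * (Real.pi / (n + 1 : ℕ)) =
      Real.pi - (a + 1 : ℕ) * (Real.pi / (n + 1 : ℕ)) := by
    have e' : ((b + 1 : ℕ) : ℝ) = (n + 1 : ℕ) - (a + 1 : ℕ) := by
      have := congrArg (Nat.cast (R := ℝ)) hsum; push_cast at this ⊢; linarith
    rw [e']
    field_simp
  rw [e, Real.sin_pi_sub] at hs1
  set x := Real.pi / (n + 1 : ℕ) with hx
  have hs1' : -(Real.sin (t * (2 * Real.cos x)) : ℂ) * Complex.I = β := by
    refine mul_right_cancel₀ (Complex.ofReal_ne_zero.2 hsa.ne') ?_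
    rw [Complex.ofReal_mul] at hs1
    linear_combination hs1
  -- The eigenvector with `k = 1` is symmetric and those with `k = 2, 4` are antisymmetric, so the
  -- phase for `k = 2` agrees modulo `2π` with minus that for `k = 1` and with that for `k = 4`.
  have hs12 : Real.sin (t * (2 * Real.cos ((2 : ℕ) * x))) = Real.sin (-(t * (2 * Real.cos x))) := by
    rw [← hs2] at hs1'
    have := mul_right_cancel₀ Complex.I_ne_zero hs1'
    rw [Real.sin_neg]
    exact_mod_cast this.symm
  have hs24 : Real.sin (t * (2 * Real.cos ((2 : ℕ) * x))) =
      Real.sin (t * (2 * Real.cos ((4 : ℕ) * x))) := by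
    rw [← hs4] at hs2
    exact_mod_cast mul_right_cancel₀ Complex.I_ne_zero hs2
  obtain ⟨p, hp⟩ := Real.exists_int_of_cos_eq_of_sin_eq
    (by rw [Real.cos_neg]; exact_mod_cast hc2.trans hc1.symm) hs12
  obtain ⟨q, hq⟩ := Real.exists_int_of_cos_eq_of_sin_eq
    (by exact_mod_cast hc2.trans hc4.symm) hs24
  have hpi := Real.pi_ne_zero
  have := le_six_of_cos_pi_div_commensurable (m := n + 1) (by omega)
    (t := t / Real.pi) (p := p) (q := q) (div_ne_zero ht hpi)
    (by
      rw [← hx]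
      push_cast at hp
      rw [div_mul_eq_mul_div, eq_div_iff hpi]
      linarith)
    (by
      rw [← hx]
      push_cast at hq
      rw [div_mul_eq_mul_div, eq_div_iff hpi]
      linarith)
  omega

/-! ### Revivals for `n = 2, 3, 4` -/

theorem pathGraph_two_admitsFractionalRevival [DecidableRel (SimpleGraph.pathGraph 2).Adj] :
    AdmitsFractionalRevival (SimpleGraph.pathGraph 2) := by
  have h1 := transitionMatrix_mulVec_of_adjMatrix_mulVec (SimpleGraph.pathGraph 2) (Real.pi / 2)
    (v := ![1, 1]) (θ := 1) (by
      ext i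
      fin_cases i <;>
        simp [Matrix.mulVec, dotProduct, Fin.sum_univ_succ, SimpleGraph.pathGraph_adj])
  have h2 := transitionMatrix_mulVec_of_adjMatrix_mulVec (SimpleGraph.pathGraph 2) (Real.pi / 2)
    (v := ![1, -1]) (θ := -1) (by
      ext i
      fin_cases i <;>
        simp [Matrix.mulVec, dotProduct, Fin.sum_univ_succ, SimpleGraph.pathGraph_adj])
  have e1 : Complex.exp (-(Complex.I * (Real.pi / 2 : ℝ)) * 1) = -Complex.I := by
    rw [← Complex.exp_neg_pi_div_two_mul_I]
    congr 1
    push_cast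
    ring
  have e2 : Complex.exp (-(Complex.I * (Real.pi / 2 : ℝ)) * -1) = Complex.I := by
    conv_rhs => rw [← Complex.exp_pi_div_two_mul_I]
    congr 1
    push_cast
    ring
  rw [e1] at h1
  rw [e2] at h2
  refine ⟨0, 1, Real.pi / 2, by decide, by positivity, 0, -Complex.I, by simp, by simp, ?_⟩
  have hv : (Pi.single 0 1 : Fin 2 → ℂ) = (1 / 2 : ℂ) • ![1, 1] + (1 / 2 : ℂ) • ![1, -1] := by
    ext i
    fin_cases i <;> simp <;> norm_num
  rw [hv, Matrix.mulVec_add, Matrix.mulVec_smul, Matrix.mulVec_smul, h1, h2]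
  ext i
  fin_cases i <;> simp <;> ring

/-- At time `π / √2` the eigenvalues `±√2` have phase `-1` and `0` has phase `1`, so the end
vertices are swapped up to sign. -/
theorem pathGraph_three_admitsFractionalRevival [DecidableRel (SimpleGraph.pathGraph 3).Adj] :
    AdmitsFractionalRevival (SimpleGraph.pathGraph 3) := by
  have hs : ((Real.sqrt 2 : ℝ) : ℂ) * (Real.sqrt 2 : ℝ) = 2 := by
    rw [← Complex.ofReal_mul, Real.mul_self_sqrt (by norm_num)]
    norm_num
  set s := Real.sqrt 2 with hsdef
  have hs0 : s ≠ 0 := by positivity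
  have h0 := transitionMatrix_mulVec_of_adjMatrix_mulVec (SimpleGraph.pathGraph 3) (Real.pi / s)
    (v := ![1, 0, -1]) (θ := 0) (by
      ext i
      fin_cases i <;>
        simp [Matrix.mulVec, dotProduct, Fin.sum_univ_succ, SimpleGraph.pathGraph_adj])
  have h1 := transitionMatrix_mulVec_of_adjMatrix_mulVec (SimpleGraph.pathGraph 3) (Real.pi / s)
    (v := ![1, s, 1]) (θ := s) (by
      ext i
      fin_cases i <;>
        simp [Matrix.mulVec, dotProduct, Fin.sum_univ_succ, SimpleGraph.pathGraph_adj, hs]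
      norm_num)
  have h2 := transitionMatrix_mulVec_of_adjMatrix_mulVec (SimpleGraph.pathGraph 3) (Real.pi / s)
    (v := ![1, -s, 1]) (θ := -s) (by
      ext i
      fin_cases i <;>
        simp [Matrix.mulVec, dotProduct, Fin.sum_univ_succ, SimpleGraph.pathGraph_adj, hs]
      norm_num)
  have hs0' : (s : ℂ) ≠ 0 := Complex.ofReal_ne_zero.2 hs0
  have e1 : Complex.exp (-(Complex.I * (Real.pi / s : ℝ)) * s) = -1 := by
    rw [← Complex.exp_neg_pi_mul_I]
    congr 1
    push_cast
    field_simp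
  have e2 : Complex.exp (-(Complex.I * (Real.pi / s : ℝ)) * -s) = -1 := by
    rw [← Complex.exp_pi_mul_I]
    congr 1
    push_cast
    field_simp
  rw [mul_zero, Complex.exp_zero] at h0
  rw [e1] at h1
  rw [e2] at h2
  refine ⟨0, 2, Real.pi / s, by decide, by positivity, 0, -1, by simp, by simp, ?_⟩
  have hv : (Pi.single 0 1 : Fin 3 → ℂ) = (1 / 2 : ℂ) • ![1, 0, -1] +
      ((1 / 4 : ℂ) • ![1, (s : ℂ), 1] + (1 / 4 : ℂ) • ![1, -(s : ℂ), 1]) := by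
    ext i
    fin_cases i <;> simp <;> norm_num
  rw [hv, Matrix.mulVec_add, Matrix.mulVec_add, Matrix.mulVec_smul, Matrix.mulVec_smul,
    Matrix.mulVec_smul, h0, h1, h2]
  ext i
  fin_cases i <;> simp <;> norm_num

theorem pathGraph_four_adjMatrix_mulVec [DecidableRel (SimpleGraph.pathGraph 4).Adj]
    {ε φ : ℂ} (hε : ε ^ 2 = 1) (hφ : φ ^ 2 = φ + 1) :
    (SimpleGraph.pathGraph 4).adjMatrix ℂ *ᵥ ![1, ε * φ, φ, ε] =
      (ε * φ) • ![1, ε * φ, φ, ε] := by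
  ext i
  fin_cases i <;>
    simp [Matrix.mulVec, dotProduct, Fin.sum_univ_succ, SimpleGraph.pathGraph_adj]
  · linear_combination (-φ ^ 2) * hε - hφ
  · linear_combination (-ε) * hφ
  · linear_combination (-φ) * hε

/-- For each reflection sign `ε`, the two eigenvalues `ε (1 ± √5) / 2` differ by `√5` in absolute
value, so their phases coincide at time `2π / √5`. Hence `e_1 + ε e_4`, a combination of these two
eigenvectors, is itself an eigenvector of `U`. -/
theorem pathGraph_four_admitsFractionalRevival [DecidableRel (SimpleGraph.pathGraph 4).Adj] :
    AdmitsFractionalRevival (SimpleGraph.pathGraph 4) := by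
  have hs : Real.sqrt 5 * Real.sqrt 5 = 5 := Real.mul_self_sqrt (by norm_num)
  have hs1 : 1 < Real.sqrt 5 := by
    rw [Real.lt_sqrt (by norm_num)]; norm_num
  set s := Real.sqrt 5
  have hs0 : s ≠ 0 := by positivity
  have hs' : (s : ℂ) * s = 5 := by exact_mod_cast hs
  have hs0' : (s : ℂ) ≠ 0 := Complex.ofReal_ne_zero.2 hs0
  have hφ : ((1 + s) / 2 : ℂ) ^ 2 = (1 + s) / 2 + 1 := by linear_combination hs' / 4
  have hψ : ((1 - s) / 2 : ℂ) ^ 2 = (1 - s) / 2 + 1 := by linear_combination hs' / 4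
  set δ : ℝ := Real.pi * (1 + 1 / s)
  have hsin : Real.sin δ ≠ 0 := by
    have e : δ = Real.pi / s + Real.pi := by simp only [δ]; ring
    rw [e, Real.sin_add_pi]
    refine neg_ne_zero.2 (Real.sin_pos_of_pos_of_lt_pi (by positivity) ?_).ne'
    exact div_lt_self Real.pi_pos hs1
  have key : ∀ ε : ℂ, ε = 1 ∨ ε = -1 →
      transitionMatrix (SimpleGraph.pathGraph 4) (2 * Real.pi / s) *ᵥ ![1, 0, 0, ε] =
        Complex.exp (-(δ * ε * Complex.I)) • ![1, 0, 0, ε] := by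
    intro ε hε
    have hε2 : ε ^ 2 = 1 := by rcases hε with rfl | rfl <;> norm_num
    have h1 := transitionMatrix_mulVec_of_adjMatrix_mulVec (SimpleGraph.pathGraph 4)
      (2 * Real.pi / s) (pathGraph_four_adjMatrix_mulVec hε2 hφ)
    have h2 := transitionMatrix_mulVec_of_adjMatrix_mulVec (SimpleGraph.pathGraph 4)
      (2 * Real.pi / s) (pathGraph_four_adjMatrix_mulVec hε2 hψ)
    have e1 : -(Complex.I * (2 * Real.pi / s : ℝ)) * (ε * ((1 + s) / 2)) =
        -(δ * ε * Complex.I) := by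
      simp only [δ]
      push_cast
      field_simp
      ring
    have e2 : Complex.exp (-(Complex.I * (2 * Real.pi / s : ℝ)) * (ε * ((1 - s) / 2))) =
        Complex.exp (-(δ * ε * Complex.I)) := by
      rw [Complex.exp_eq_exp_iff_exists_int]
      rcases hε with rfl | rfl
      · refine ⟨1, ?_⟩
        simp only [δ]
        push_cast
        field_simp
        ring
      · refine ⟨-1, ?_⟩
        simp only [δ]
        push_cast
        field_simp
        ring
    rw [e1] at h1
    rw [e2] at h2
    -- The weights sum to `1` and cancel the two middle entries.
    have hv : (![1, 0, 0, ε] : Fin 4 → ℂ) =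
        ((s - 1) / (2 * s) : ℂ) • ![1, ε * ((1 + s) / 2), (1 + s) / 2, ε] +
          ((s + 1) / (2 * s) : ℂ) • ![1, ε * ((1 - s) / 2), (1 - s) / 2, ε] := by
      ext i
      fin_cases i <;> simp <;> field_simp <;> ring
    rw [hv, Matrix.mulVec_add, Matrix.mulVec_smul, Matrix.mulVec_smul, h1, h2, smul_add,
      smul_comm, smul_comm (Complex.exp _) ((s + 1) / (2 * s) : ℂ)]
  have k1 := key 1 (Or.inl rfl)
  have k2 := key (-1) (Or.inr rfl)
  have e1 : Complex.exp (-(δ * 1 * Complex.I)) = Real.cos δ - Real.sin δ * Complex.I := by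
    rw [mul_one, ← neg_mul, Complex.exp_mul_I, Complex.cos_neg, Complex.sin_neg]
    push_cast
    ring
  have e2 : Complex.exp (-(δ * -1 * Complex.I)) = Real.cos δ + Real.sin δ * Complex.I := by
    rw [mul_neg_one, ← neg_mul, neg_neg, Complex.exp_mul_I]
    push_cast
    ring
  rw [e1] at k1
  rw [e2] at k2
  refine ⟨0, 3, 2 * Real.pi / s, by decide, by positivity, Real.cos δ,
    -(Real.sin δ) * Complex.I, ?_, ?_, ?_⟩
  · rw [norm_mul, norm_neg, Complex.norm_I, Complex.norm_real, Complex.norm_real, mul_one,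
      Real.norm_eq_abs, Real.norm_eq_abs, sq_abs, sq_abs, Real.cos_sq_add_sin_sq]
  · exact mul_ne_zero (neg_ne_zero.2 (Complex.ofReal_ne_zero.2 hsin)) Complex.I_ne_zero
  · have hv : (Pi.single 0 1 : Fin 4 → ℂ) =
        (1 / 2 : ℂ) • ![1, 0, 0, 1] + (1 / 2 : ℂ) • ![1, 0, 0, -1] := by
      ext i
      fin_cases i <;> simp <;> norm_num
    rw [hv, Matrix.mulVec_add, Matrix.mulVec_smul, Matrix.mulVec_smul, k1, k2]
    ext i
    fin_cases i <;> simp <;> ring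

theorem mainTheorem1 (n : ℕ) [DecidableRel (SimpleGraph.pathGraph n).Adj] :
    AdmitsFractionalRevival (SimpleGraph.pathGraph n) ↔ n ∈ ({2, 3, 4} : Set ℕ) := by
  constructor
  · rintro ⟨a, b, t, hab, ht, α, β, hαβ, hβ, hr⟩
    have h4 : n ≤ 4 := by
      rcases Nat.even_or_odd (a + b : ℕ) with hpar | hpar
      · exact le_four_of_pathGraph_revival_of_even ht hab hβ hr hpar
      · exact le_four_of_pathGraph_revival_of_odd ht hab hαβ hβ hr hpar
    have h2 : 2 ≤ n := by
      have := a.2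
      have := b.2
      have := fun h => hab (Fin.ext h)
      omega
    interval_cases n <;> simp
  · rintro (rfl | rfl | rfl)
    · exact pathGraph_two_admitsFractionalRevival
    · exact pathGraph_three_admitsFractionalRevival
    · exact pathGraph_four_admitsFractionalRevival
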